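/- Let $\mathbb F_q$ be the finite field with $q$ elements, let $F_1\subsetneq F_2\subsetneq\cdots\subsetneq F_\lambda$ be subfields of $\mathbb F_q$, and let $\mu_1,\dots,\mu_\lambda$ be positive integers. Put $s_t=\mu_1+\cdots+\mu_t$ for $0\le t\le\lambda$ (so $s_0=0$) and $m=s_\lambda$. For $1\le i\le m$ let $t_i$ be the unique integer with $s_{t_i-1}<i\le s_{t_i}$, and put $A_i=F_{t_i}$, $d_i=|A_i|$ and $\mathcal A=A_1\times\cdots\times A_m=F_1^{\mu_1}\times\cdots\times F_\lambda^{\mu_\lambda}\subseteq\mathbb F_q^m$. Let $\mathrm{Aff}(\mathcal A)$ be the set of maps $\phi:\mathcal A\to\mathcal A$ with $\phi(\mathcal A)=\mathcal A$ that are restrictions to $\mathcal A$ of maps $X\mapsto MX+b$ with $M\in\mathrm{GL}(m,\mathbb F_q)$ and $b\in\mathbb F_q^m$. For $f\in\mathbb F_q[X_1,\dots,X_m]$, or any function $f:\mathcal A\to\mathbb F_q$, let $\mathbf c_f=(f(P))_{P\in\mathcal A}\in\mathbb F_q^{\mathcal A}$. An integer $u$ with $1\le u\le\sum_{i=1}^m(d_i-1)$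 can be written uniquely as $u=\sum_{i=1}^{j}(d_i-1)+\ell$ with $0\le j<m$ and $0<\ell\le d_{j+1}-1$. For $1\le k\le j+1$ with $d_k\ge d_{j+1}-\ell$, let $N^{(k)}(u,\mathcal A)$ be the set of all codewords $\mathbf c_{\gamma\cdot(h_k^{\Omega}\circ\sigma)}$ with $\gamma\in\mathbb F_q^*$, $\sigma\in\mathrm{Aff}(\mathcal A)$ and $\Omega\subseteq A_k$ of size $d_k-(d_{j+1}-\ell)$, where $$h_k^{\Omega}(X_1,\dots,X_m)=\prod_{\substack{1\le i\le j+1\\ i\ne k}}\bigl(1-X_i^{d_i-1}\bigr)\prod_{\omega\in\Omega}(X_k-\omega).$$ For a prime power $Q$, let $\binom{n}{t}_{Q}$ denote the $Q$-binomial coefficient, i.e. the number of $t$-dimensional linear subspaces of $\mathbb F_Q^n$. **Theorem.** Let $u=\sum_{i=1}^{j}(d_i-1)+\ell$ with $0\le j<m$ and $0<\ell<d_{j+1}-1$, let $r=t_{j+1}$, and let $1\le k\le j+1$ be such that $t_k<r$ and $d_k=d_{j+1}-\ell$. Then $$\bigl|N^{(k)}(u,\mathcal A)\bigr|=(q-1)\Biggl(\prod_{\substack{1\le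 i\le j+1\\ i\neq k}}d_i\Biggr)\Biggl(\prod_{i=s_{t_k}+1}^{j+1}d_i\Biggr)\binom{\mu_r}{j+1-s_{r-1}}_{d_{j+1}}\binom{\mu_{t_k}}{1}_{d_k}.$$ -/

import Mathlib

/-- `qBinom L n t` is the `q`-binomial coefficient `[n choose t]_q` for `q = |L|`: the number of
`t`-dimensional linear subspaces of `L ^ n`, where `L` is a finite field. -/
noncomputable def qBinom (L : Type*) [Field L] (n t : ℕ) : ℕ :=
  Nat.card {W : Submodule L (Fin n → L) // Module.finrank L W = t}

/-- The data of a product `F 1 ^ μ 1 × ⋯ × F lam ^ μ lam` of nested subfields of `K`: subfields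
`F 1 ⊊ ⋯ ⊊ F lam` of `K` and positive multiplicities `μ 1, …, μ lam`. Only the values of `F` and
`μ` at `1, …, lam` are meaningful. -/
structure NestedSubfields (K : Type*) [Field K] where
  lam : ℕ
  F : ℕ → Subfield K
  μ : ℕ → ℕ
  strictMonoOn_F : StrictMonoOn F (Set.Icc 1 lam)
  μ_pos : ∀ t ∈ Set.Icc 1 lam, 0 < μ t

namespace NestedSubfields

variable {K : Type*} [Field K] (S : NestedSubfields K)

/-- `s t = μ 1 + ⋯ + μ t`, so `s 0 = 0`. -/
def s (t : ℕ) : ℕ := ∑ i ∈ Finset.Icc 1 t, S.μ i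

/-- The number `m = μ 1 + ⋯ + μ lam` of coordinates. -/
def m : ℕ := S.s S.lam

/-- For `1 ≤ i ≤ m`, the unique `t` with `s (t - 1) < i ≤ s t` (see `block_spec`). -/
noncomputable def block (i : ℕ) : ℕ := sInf {t | i ≤ S.s t}

theorem block_spec {i : ℕ} (h1 : 1 ≤ i) (hm : i ≤ S.m) :
    1 ≤ S.block i ∧ S.block i ≤ S.lam ∧ S.s (S.block i - 1) < i ∧ i ≤ S.s (S.block i) := by
  have hmem : S.lam ∈ {t | i ≤ S.s t} := hm
  have h : i ≤ S.s (S.block i) := Nat.sInf_mem (s := {t | i ≤ S.s t}) ⟨_, hmem⟩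
  have hpos : 1 ≤ S.block i := by
    rcases Nat.eq_zero_or_pos (S.block i) with h0 | h0
    · rw [h0] at h
      simp [s] at h
      omega
    · exact h0
  refine ⟨hpos, Nat.sInf_le hmem, ?_, h⟩
  have hn : S.block i - 1 ∉ {t | i ≤ S.s t} :=
    Nat.notMem_of_lt_sInf (show S.block i - 1 < S.block i by omega)
  simpa using hn

/-- The `i`-th factor `A_i` of the product, `1 ≤ i ≤ m`. -/
noncomputable def A (i : ℕ) : Subfield K := S.F (S.block i)

/-- `d_i = |A_i|`. -/
noncomputable def d (i : ℕ) : ℕ := Nat.card (S.A i)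

/-- The set `{1, …, m}` indexing the coordinates. -/
abbrev Idx : Type := ↥(Finset.Icc 1 S.m)

/-- The product `𝒜 = A_1 × ⋯ × A_m ⊆ K ^ m`. -/
def points : Set (S.Idx → K) := {x | ∀ i : S.Idx, x i ∈ S.A i}

/-- The affine group of `𝒜`: the maps `φ : 𝒜 → 𝒜` that are restrictions of an affine
transformation `x ↦ M x + b` of `K ^ m`, with `M` invertible, such that `φ(𝒜) = 𝒜`. -/
def aff : Set (S.points → S.points) :=
  {φ | (∃ (M : GL S.Idx K) (b : S.Idx → K), ∀ x : S.points,
      (φ x : S.Idx → K) = (M : Matrix S.Idx S.Idx K).mulVec (x : S.Idx → K) + b) ∧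
    Set.range φ = Set.univ}

/-- The codeword `c_f` of a polynomial `f`: the vector, indexed by the points of `𝒜`, of the values
of `f`. -/
noncomputable def ev (f : MvPolynomial S.Idx K) : S.points → K :=
  fun P => MvPolynomial.eval (P : S.Idx → K) f

/-- The polynomial `h_k^Ω = ∏_{1 ≤ i ≤ j + 1, i ≠ k} (1 - X_i ^ (d_i - 1)) ∏_{ω ∈ Ω} (X_k - ω)`. -/
noncomputable def h (j : ℕ) (k : S.Idx) (Ω : Finset K) : MvPolynomial S.Idx K :=
  (∏ i ∈ Finset.univ.filter (fun i : S.Idx => (i : ℕ) ≤ j + 1 ∧ i ≠ k),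
      (1 - MvPolynomial.X i ^ (S.d i - 1))) *
    ∏ ω ∈ Ω, (MvPolynomial.X k - MvPolynomial.C ω)

/-- The set `N^(k, Ω)` of the codewords of `γ · h_k^Ω ∘ σ` for `γ ∈ K^*` and `σ ∈ Aff(𝒜)`. -/
def wordsOmega (j : ℕ) (k : S.Idx) (Ω : Finset K) : Set (S.points → K) :=
  {c | ∃ γ : K, γ ≠ 0 ∧ ∃ σ ∈ S.aff, ∀ P, c P = γ * S.ev (S.h j k Ω) (σ P)}

/-- `j` and `l` are the integers with `u = ∑_{i = 1}^j (d_i - 1) + l`, `0 ≤ j < m` and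
`0 < l ≤ d_{j + 1} - 1`; they are determined by `u`. -/
def IsDecomp (u j l : ℕ) : Prop :=
  j < S.m ∧ 0 < l ∧ l ≤ S.d (j + 1) - 1 ∧ u = (∑ i ∈ Finset.Icc 1 j, (S.d i - 1)) + l

/-- The set `N^(k)(u, 𝒜)`: the union of the sets `N^(k, Ω)` over all `Ω ⊆ A_k` with
`|Ω| = d_k - (d_{j + 1} - l)`, where `j`, `l` belong to `u`, for `k ≤ j + 1` with
`d_k ≥ d_{j + 1} - l`. -/
def words (u : ℕ) (k : S.Idx) : Set (S.points → K) :=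
  {c | ∃ j l, S.IsDecomp u j l ∧ (k : ℕ) ≤ j + 1 ∧ S.d (j + 1) - l ≤ S.d k ∧
    ∃ Ω : Finset K, (Ω : Set K) ⊆ S.A k ∧ Ω.card = S.d k - (S.d (j + 1) - l) ∧
      c ∈ S.wordsOmega j k Ω}

end NestedSubfields

/-! Since `d_k = d_{j+1} - l`, the set `Ω` is empty, and on `𝒜` the polynomial `h_k^∅` is the
indicator of the subgroup `H` of points whose coordinates up to `j + 1`, except the `k`-th, vanish.
Each word is therefore a nonzero scalar times the indicator of a nonempty set `σ⁻¹(H)`. It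
determines both scalar and set, which gives the factor `q - 1` (`ncard_wordsOmega_empty`).

The sets `σ⁻¹(H)` are the cosets in `𝒜` of the subgroups `g(H)`, with `g` a linear automorphism
preserving `𝒜` (`affPreimages_eq`). Each `g(H)` has `|𝒜| / |H| = ∏_{i ≤ j+1, i ≠ k} d_i` cosets
(`ncard_cosets_mul`).

To count the `g(H)`, write `H = A_k e_k + tail (j + 1)`. The automorphisms preserve the flag of the
`tail (s t)`. With `R = tail (s (t_k - 1))` and `Q = tail (s t_k)`, the images are exactly the `A_k
v + W` with `v ∈ R \ Q` and `W` in the orbit of `tail (j + 1)` (`linImages_zeroSet_eq`). Modulo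
`tail (s r)`, the `W` are all subspaces of `F_r ^ μ_r` of codimension `j + 1 - s (r - 1)`
(`tailOrbit_eq`). As `W = (A_k v + W) ∩ Q`, each image comes from `(d_k - 1) |W|` pairs
(`ncard_adjoinLine_mul`). Finally `|R| - |Q| = (d_k ^ μ - 1) |Q|` with `μ = μ_{t_k}`; the quotient
`|Q| / |W|` is the second product, and `(d_k ^ μ - 1) / (d_k - 1)` counts lines. -/

theorem Set.ncard_eq_ncard_image_mul {α β : Type*} {s : Set α} (hs : s.Finite) (f : α → β) (n : ℕ)
    (hf : ∀ a ∈ s, {a' ∈ s | f a' = f a}.ncard = n) : s.ncard = (f '' s).ncard * n := by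
  classical
  lift s to Finset α using hs
  rw [Set.ncard_coe_finset, ← Finset.coe_image, Set.ncard_coe_finset,
    Finset.card_eq_sum_card_image f s, Finset.sum_const_nat (m := n)]
  intro b hb
  obtain ⟨a, ha, rfl⟩ := Finset.mem_image.1 hb
  rw [← hf a ha, ← Set.ncard_coe_finset]
  congr 1
  ext x
  simp

/-- The cosets of the subgroups in `ℒ`, all of which have `w` elements. -/
theorem ncard_cosets_mul {E : Type*} [AddCommGroup E] [Finite E] (R : AddSubgroup E)
    (ℒ : Set (AddSubgroup E)) (w : ℕ) (hle : ∀ H ∈ ℒ, H ≤ R)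
    (hw : ∀ H ∈ ℒ, (H : Set E).ncard = w) :
    {C : Set E | ∃ b ∈ R, ∃ H ∈ ℒ, C = {x | x - b ∈ H}}.ncard * w =
      (R : Set E).ncard * ℒ.ncard := by
  rw [← Set.ncard_prod, Set.ncard_eq_ncard_image_mul (Set.toFinite _)
    (fun p : E × AddSubgroup E => {x | x - p.1 ∈ p.2}) w]
  · congr 2
    ext C
    simp only [Set.mem_ofPred_eq, Set.mem_image, Set.mem_prod, SetLike.mem_coe, Prod.exists]
    constructor
    · rintro ⟨b, hb, H, hH, rfl⟩
      exact ⟨b, H, ⟨hb, hH⟩, rfl⟩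
    · rintro ⟨b, H, ⟨hb, hH⟩, rfl⟩
      exact ⟨b, hb, H, hH, rfl⟩
  · rintro ⟨b, H⟩ ⟨hb, hH⟩
    simp only [SetLike.mem_coe] at hb hH
    -- The pairs giving the coset `b + H` are the `(b + h, H)` with `h ∈ H`: a coset determines its
    -- subgroup.
    rw [← hw H hH, ← Set.ncard_image_of_injective (H : Set E)
      (f := fun h => ((b + h, H) : E × AddSubgroup E))]
    · congr 1
      ext ⟨b', H'⟩
      simp only [Set.mem_ofPred_eq, Set.mem_image, Set.mem_prod, SetLike.mem_coe, Prod.mk.injEq]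
      constructor
      · rintro ⟨⟨hb', hH'⟩, h⟩
        have h1 : ∀ x, x - b' ∈ H' ↔ x - b ∈ H := fun x => Set.ext_iff.1 h x
        have h2 : b' - b ∈ H := (h1 b').1 (by simp)
        refine ⟨b' - b, h2, by abel, ?_⟩
        ext y
        have := h1 (y + b')
        rw [add_sub_cancel_right] at this
        rw [this, show y + b' - b = y + (b' - b) by abel, H.add_mem_cancel_right h2]
      · rintro ⟨h, hh, rfl, rfl⟩
        refine ⟨⟨R.add_mem hb (hle _ hH hh), hH⟩, ?_⟩
        ext x
        simp only [Set.mem_ofPred_eq]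
        rw [show x - b = (x - (b + h)) + h by abel, H.add_mem_cancel_right hh]
    · intro x y h
      simpa using h

/-- The subgroup `F v + W`. -/
def AddSubgroup.adjoinLine {K E : Type*} [Field K] [AddCommGroup E] [Module K E] (F : Subfield K)
    (v : E) (W : AddSubgroup E) : AddSubgroup E where
  carrier := {x | ∃ c ∈ F, ∃ w ∈ W, x = c • v + w}
  zero_mem' := ⟨0, F.zero_mem, 0, W.zero_mem, by simp⟩
  add_mem' := by
    rintro _ _ ⟨c, hc, w, hw, rfl⟩ ⟨c', hc', w', hw', rfl⟩
    exact ⟨c + c', F.add_mem hc hc', w + w', W.add_mem hw hw', by rw [add_smul]; abel⟩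
  neg_mem' := by
    rintro _ ⟨c, hc, w, hw, rfl⟩
    exact ⟨-c, F.neg_mem hc, -w, W.neg_mem hw, by rw [neg_smul]; abel⟩

/-! ### Subgroups spanned by a line and a smaller subgroup -/

section adjoinLine

open AddSubgroup

variable {K E : Type*} [Field K] [AddCommGroup E] [Module K E] {F : Subfield K}

theorem AddSubgroup.mem_adjoinLine {v x : E} {W : AddSubgroup E} :
    x ∈ adjoinLine F v W ↔ ∃ c ∈ F, ∃ w ∈ W, x = c • v + w := Iff.rfl

theorem AddSubgroup.map_adjoinLine (g : E ≃ₗ[K] E) (v : E) (W : AddSubgroup E) :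
    (adjoinLine F v W).map (g : E →+ E) = adjoinLine F (g v) (W.map (g : E →+ E)) := by
  ext x
  simp only [AddSubgroup.mem_map, mem_adjoinLine]
  constructor
  · rintro ⟨_, ⟨c, hc, w, hw, rfl⟩, rfl⟩
    exact ⟨c, hc, g w, ⟨w, hw, rfl⟩, by simp⟩
  · rintro ⟨c, hc, _, ⟨w, hw, rfl⟩, rfl⟩
    exact ⟨c • v + w, ⟨c, hc, w, hw, rfl⟩, by simp⟩

theorem AddSubgroup.adjoinLine_smul_add {v w : E} {W : AddSubgroup E}
    (hW : ∀ c ∈ F, ∀ x ∈ W, c • x ∈ W)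
    {c : K} (hc : c ∈ F) (hc0 : c ≠ 0) (hw : w ∈ W) :
    adjoinLine F (c • v + w) W = adjoinLine F v W := by
  ext x
  simp only [mem_adjoinLine]
  constructor
  · rintro ⟨a, ha, w', hw', rfl⟩
    exact ⟨a * c, F.mul_mem ha hc, a • w + w', W.add_mem (hW a ha w hw) hw',
      by rw [smul_add, smul_smul]; abel⟩
  · rintro ⟨a, ha, w', hw', rfl⟩
    refine ⟨a * c⁻¹, F.mul_mem ha (F.inv_mem hc), w' - (a * c⁻¹) • w,
      W.sub_mem hw' (hW _ (F.mul_mem ha (F.inv_mem hc)) w hw), ?_⟩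
    rw [smul_add, smul_smul, inv_mul_cancel_right₀ hc0]
    abel

/-- The subgroups `F v + W` with `v ∈ R \ Q` and `W ∈ 𝒲`, where `W ≤ Q ≤ R`. -/
theorem ncard_adjoinLine_mul [Finite E] [Finite K] (Q R : AddSubgroup E) (hQR : Q ≤ R)
    (hQ : ∀ c ∈ F, ∀ x ∈ Q, c • x ∈ Q) (hR : ∀ c ∈ F, ∀ x ∈ R, c • x ∈ R)
    (𝒲 : Set (AddSubgroup E)) (w : ℕ) (hle : ∀ W ∈ 𝒲, W ≤ Q)
    (hsmul : ∀ W ∈ 𝒲, ∀ c ∈ F, ∀ x ∈ W, c • x ∈ W) (hw : ∀ W ∈ 𝒲, (W : Set E).ncard = w) :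
    {H : AddSubgroup E | ∃ v ∈ R, v ∉ Q ∧ ∃ W ∈ 𝒲, H = adjoinLine F v W}.ncard *
        ((Nat.card F - 1) * w) =
      ((R : Set E).ncard - (Q : Set E).ncard) * 𝒲.ncard := by
  rw [← Set.ncard_sdiff (SetLike.coe_subset_coe.2 hQR), ← Set.ncard_prod,
    Set.ncard_eq_ncard_image_mul (Set.toFinite _)
      (fun p : E × AddSubgroup E => adjoinLine F p.1 p.2) ((Nat.card F - 1) * w)]
  · congr 2
    ext H
    simp only [Set.mem_ofPred_eq, Set.mem_image, Set.mem_prod, SetLike.mem_coe, Prod.exists,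
      Set.mem_sdiff]
    constructor
    · rintro ⟨v, hv, hv', W, hW, rfl⟩
      exact ⟨v, W, ⟨⟨hv, hv'⟩, hW⟩, rfl⟩
    · rintro ⟨v, W, ⟨⟨hv, hv'⟩, hW⟩, rfl⟩
      exact ⟨v, hv, hv', W, hW, rfl⟩
  · rintro ⟨v, W⟩ ⟨⟨hv, hv'⟩, hW⟩
    simp only [SetLike.mem_coe] at hv hv' hW
    have key : ∀ c ∈ F, ∀ x ∈ Q, c • v + x ∈ Q → c = 0 := by
      intro c hc x hx h
      by_contra hc0
      refine hv' ?_
      have := hQ _ (F.inv_mem hc) _ ((Q.add_mem_cancel_right hx).1 h)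
      rwa [smul_smul, inv_mul_cancel₀ hc0, one_smul] at this
    -- `W'` is recovered from `F v' + W'` by intersecting with `Q`, so equal sums have equal second
    -- components.
    have inter : ∀ v' W', v' ∈ R → v' ∉ Q → W' ∈ 𝒲 → ∀ x,
        x ∈ W' ↔ x ∈ adjoinLine F v' W' ∧ x ∈ Q := by
      intro v' W' hvR hvQ hW' x
      refine ⟨fun hx => ⟨⟨0, F.zero_mem, x, hx, by simp⟩, hle _ hW' hx⟩, ?_⟩
      rintro ⟨⟨c, hc, x, hx, rfl⟩, h⟩
      have hc0 : c = 0 := by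
        by_contra hc0
        refine hvQ ?_
        have := hQ _ (F.inv_mem hc) _ ((Q.add_mem_cancel_right (hle _ hW' hx)).1 h)
        rwa [smul_smul, inv_mul_cancel₀ hc0, one_smul] at this
      simpa [hc0] using hx
    have hcard : ({c : K | c ∈ F} \ {0}).ncard = Nat.card F - 1 := by
      rw [Set.ncard_sdiff_singleton_of_mem (show (0 : K) ∈ {c : K | c ∈ F} from F.zero_mem)]
      rfl
    -- The fibre is parametrized by the replacements `v ↦ c v + x` with `c ∈ F` nonzero and `x ∈ W`.
    rw [← hw W hW, ← hcard, ← Set.ncard_prod, ← Set.InjOn.ncard_image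
      (f := fun p : K × E => ((p.1 • v + p.2, W) : E × AddSubgroup E))]
    · congr 1
      ext ⟨v', W'⟩
      simp only [Set.mem_ofPred_eq, Set.mem_image, Set.mem_prod, SetLike.mem_coe, Prod.mk.injEq,
        Set.mem_sdiff, Set.mem_singleton_iff, Prod.exists]
      constructor
      · rintro ⟨⟨⟨hv1, hv2⟩, hW'⟩, h⟩
        have hWW : W' = W := by
          ext x
          rw [inter v' W' hv1 hv2 hW', inter v W hv hv' hW, h]
        have hm : v' ∈ adjoinLine F v W := by
          rw [← h]
          exact ⟨1, F.one_mem, 0, W'.zero_mem, by simp⟩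
        obtain ⟨c, hc, x, hx, rfl⟩ := hm
        refine ⟨c, x, ⟨⟨hc, ?_⟩, hx⟩, rfl, hWW.symm⟩
        rintro rfl
        exact hv2 (by simpa using hle _ hW hx)
      · rintro ⟨c, x, ⟨⟨hc, hc0⟩, hx⟩, rfl, rfl⟩
        refine ⟨⟨⟨R.add_mem (hR c hc v hv) (hQR (hle _ hW hx)), fun h => hc0 ?_⟩, hW⟩, ?_⟩
        · exact key c hc x (hle _ hW hx) h
        · exact adjoinLine_smul_add (hsmul _ hW) hc hc0 hx
    · rintro ⟨c, x⟩ ⟨⟨hc, -⟩, hx⟩ ⟨c', x'⟩ ⟨⟨hc', -⟩, hx'⟩ h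
      simp only [Prod.mk.injEq, and_true] at h
      simp only [Set.mem_ofPred_eq, SetLike.mem_coe] at hc hc' hx hx'
      have h1 : c - c' = 0 := by
        refine key _ (F.sub_mem hc hc') 0 Q.zero_mem ?_
        have : (c - c') • v + 0 = x' - x := by
          rw [sub_smul, add_zero, sub_eq_sub_iff_add_eq_add, h, add_comm]
        rw [this]
        exact Q.sub_mem (hle _ hW hx') (hle _ hW hx)
      have h2 : c = c' := sub_eq_zero.1 h1
      subst h2
      simpa using h

end adjoinLine

/-! ### Linear algebra and Gaussian binomials -/

theorem Submodule.exists_linearEquiv_map_eq {L V : Type*} [Field L] [AddCommGroup V] [Module L V]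
    [FiniteDimensional L V] (U U' : Submodule L V)
    (h : Module.finrank L U = Module.finrank L U') :
    ∃ e : V ≃ₗ[L] V, U.map (e : V →ₗ[L] V) = U' := by
  obtain ⟨C, hC⟩ := U.exists_isCompl
  obtain ⟨C', hC'⟩ := U'.exists_isCompl
  have h1 := Submodule.finrank_add_eq_of_isCompl hC
  have h2 := Submodule.finrank_add_eq_of_isCompl hC'
  let e1 : U ≃ₗ[L] U' := LinearEquiv.ofFinrankEq _ _ h
  let e2 : C ≃ₗ[L] C' := LinearEquiv.ofFinrankEq _ _ (by omega)
  let e := (Submodule.prodEquivOfIsCompl U C hC).symm ≪≫ₗ e1.prodCongr e2 ≪≫ₗ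
    Submodule.prodEquivOfIsCompl U' C' hC'
  refine ⟨e, Submodule.eq_of_le_of_finrank_eq ?_ ?_⟩
  · rintro _ ⟨x, hx, rfl⟩
    have : e x = e1 (⟨x, hx⟩ : U) := by
      simp only [e, LinearEquiv.trans_apply]
      have h3 : (Submodule.prodEquivOfIsCompl U C hC).symm x = (⟨x, hx⟩, 0) := by
        rw [LinearEquiv.symm_apply_eq]
        simp
      rw [h3]
      simp
    simp [this]
  · rw [LinearEquiv.finrank_map_eq, h]

theorem natCard_submodule_finrank_eq {L V V' : Type*} [Field L] [AddCommGroup V] [Module L V]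
    [AddCommGroup V'] [Module L V'] (e : V ≃ₗ[L] V') (t : ℕ) :
    Nat.card {W : Submodule L V // Module.finrank L W = t} =
      Nat.card {W : Submodule L V' // Module.finrank L W = t} :=
  Nat.card_congr <| (Submodule.orderIsoMapComap e).toEquiv.subtypeEquiv fun W => by
    change _ ↔ Module.finrank L (W.map (e : V →ₗ[L] V')) = t
    rw [LinearEquiv.finrank_map_eq]

/-- Annihilators exchange dimension and codimension. This is needed because a tail cuts out a
subspace of known codimension in its block. -/
theorem qBinom_symm (L : Type*) [Field L] {n t : ℕ} (h : t ≤ n) :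
    qBinom L n (n - t) = qBinom L n t := by
  unfold qBinom
  rw [natCard_submodule_finrank_eq (Module.Free.chooseBasis L (Fin n → L)).toDualEquiv t]
  refine Nat.card_congr <| ((Subspace.orderIsoFiniteDimensional
    (K := L) (V := Fin n → L)).toEquiv.trans OrderDual.ofDual).subtypeEquiv fun W => ?_
  change _ ↔ Module.finrank L (Submodule.dualAnnihilator W) = t
  have := Subspace.finrank_add_finrank_dualAnnihilator_eq W
  rw [Module.finrank_fin_fun] at this
  omega

/-- Lines are the points of projective space. -/
theorem qBinom_one_mul (L : Type*) [Field L] [Finite L] (n : ℕ) :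
    qBinom L n 1 * (Nat.card L - 1) = Nat.card L ^ n - 1 := by
  unfold qBinom
  rw [← Nat.card_congr (Projectivization.equivSubmodule L (Fin n → L)), ← Projectivization.card]
  simp [Nat.card_fun]

/-! ### Blocks of coordinates and the tail flag -/

namespace NestedSubfields

variable {K : Type*} [Field K] (S : NestedSubfields K)

theorem s_mono : Monotone S.s := fun _ _ hab =>
  Finset.sum_le_sum_of_subset (Finset.Icc_subset_Icc le_rfl hab)

theorem s_succ (t : ℕ) : S.s (t + 1) = S.s t + S.μ (t + 1) := by
  unfold s
  rw [Finset.sum_Icc_succ_top (by omega)]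

theorem block_le_iff {i : ℕ} (h : i ≤ S.m) {t : ℕ} : S.block i ≤ t ↔ i ≤ S.s t :=
  ⟨fun ht => (Nat.sInf_mem (s := {t | i ≤ S.s t}) ⟨S.lam, h⟩).trans (S.s_mono ht),
    fun ht => Nat.sInf_le ht⟩

theorem block_eq_iff {i t : ℕ} (h : i ≤ S.m) (ht : 1 ≤ t) :
    S.block i = t ↔ S.s (t - 1) < i ∧ i ≤ S.s t := by
  rw [← S.block_le_iff h, ← not_le, ← S.block_le_iff h]
  omega

theorem A_mono {i p : ℕ} (hi : 1 ≤ i) (hp : 1 ≤ p) (him : i ≤ S.m) (hpm : p ≤ S.m)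
    (h : S.block i ≤ S.block p) : S.A i ≤ S.A p := by
  have h1 := S.block_spec hi him
  have h2 := S.block_spec hp hpm
  exact S.strictMonoOn_F.monotoneOn ⟨h1.1, h1.2.1⟩ ⟨h2.1, h2.2.1⟩ h

theorem block_le_of_A_le {i p : ℕ} (hi : 1 ≤ i) (hp : 1 ≤ p) (him : i ≤ S.m) (hpm : p ≤ S.m)
    (h : S.A i ≤ S.A p) : S.block i ≤ S.block p := by
  have h1 := S.block_spec hi him
  have h2 := S.block_spec hp hpm
  by_contra hlt
  exact absurd h (not_le_of_gt (S.strictMonoOn_F ⟨h2.1, h2.2.1⟩ ⟨h1.1, h1.2.1⟩ (not_le.1 hlt)))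

theorem d_eq_of_block_eq {i p : ℕ} (h : S.block i = S.block p) : S.d i = S.d p := by
  unfold d A
  rw [h]

variable {S}

theorem Idx.one_le (i : S.Idx) : 1 ≤ (i : ℕ) := (Finset.mem_Icc.1 i.2).1

theorem Idx.le_m (i : S.Idx) : (i : ℕ) ≤ S.m := (Finset.mem_Icc.1 i.2).2

theorem Idx.A_mono {i p : S.Idx} (h : S.block i ≤ S.block p) : S.A i ≤ S.A p :=
  S.A_mono i.one_le p.one_le i.le_m p.le_m h

variable (S)

/-- The points of `𝒜` whose coordinates vanish on `T`. -/
def vanishOn (T : Finset S.Idx) : AddSubgroup (S.Idx → K) where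
  carrier := {x | x ∈ S.points ∧ ∀ p ∈ T, x p = 0}
  zero_mem' := ⟨fun i => (S.A i).zero_mem, fun _ _ => rfl⟩
  add_mem' := fun hx hy => ⟨fun i => (S.A i).add_mem (hx.1 i) (hy.1 i),
    fun p hp => by simp [hx.2 p hp, hy.2 p hp]⟩
  neg_mem' := fun hx => ⟨fun i => (S.A i).neg_mem (hx.1 i), fun p hp => by simp [hx.2 p hp]⟩

variable {S}

theorem mem_vanishOn {T : Finset S.Idx} {x : S.Idx → K} :
    x ∈ S.vanishOn T ↔ x ∈ S.points ∧ ∀ p ∈ T, x p = 0 := Iff.rfl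

variable (S)

theorem ncard_vanishOn (T : Finset S.Idx) :
    (S.vanishOn T : Set (S.Idx → K)).ncard = ∏ p ∈ Tᶜ, S.d p := by
  classical
  let f : (S.vanishOn T) ≃ ((p : {p // p ∈ Tᶜ}) → S.A (p : S.Idx)) :=
    { toFun := fun x p => ⟨x.1 p, x.2.1 p⟩
      invFun := fun y => ⟨fun p => if h : p ∈ Tᶜ then (y ⟨p, h⟩ : K) else 0, by
        refine ⟨fun p => ?_, fun p hp => ?_⟩
        · by_cases h : p ∈ Tᶜ
          · simp only [h, dif_pos]
            exact (y ⟨p, h⟩).2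
          · simp only [h, dif_neg, not_false_eq_true]
            exact (S.A p).zero_mem
        · simp [hp]⟩
      left_inv := by
        rintro ⟨x, hx⟩
        ext p
        by_cases h : p ∈ T
        · simp [h, hx.2 p h]
        · simp [h]
      right_inv := by
        intro y
        ext ⟨p, hp⟩
        simp only [hp, dif_pos] }
  change Nat.card (S.vanishOn T) = _
  rw [Nat.card_congr f, Nat.card_pi]
  simp only [d]
  exact Finset.prod_coe_sort Tᶜ (fun p => Nat.card (S.A (p : ℕ)))

/-- The points of `𝒜` whose first `n` coordinates vanish. -/
def tail (n : ℕ) : AddSubgroup (S.Idx → K) :=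
  S.vanishOn (Finset.univ.filter fun p : S.Idx => (p : ℕ) ≤ n)

variable {S}

theorem mem_tail {n : ℕ} {x : S.Idx → K} :
    x ∈ S.tail n ↔ x ∈ S.points ∧ ∀ p : S.Idx, (p : ℕ) ≤ n → x p = 0 := by
  simp [tail, mem_vanishOn]

theorem mem_tail_zero {x : S.Idx → K} : x ∈ S.tail 0 ↔ x ∈ S.points := by
  rw [mem_tail, and_iff_left_iff_imp]
  intro _ p hp
  have := p.one_le
  omega

variable (S)

theorem tail_anti {a b : ℕ} (h : a ≤ b) : S.tail b ≤ S.tail a := fun x hx => by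
  rw [mem_tail] at hx ⊢
  exact ⟨hx.1, fun p hp => hx.2 p (hp.trans h)⟩

theorem ncard_tail (n : ℕ) :
    (S.tail n : Set (S.Idx → K)).ncard = ∏ i ∈ Finset.Icc (n + 1) S.m, S.d i := by
  rw [tail, ncard_vanishOn]
  refine Finset.prod_bij (fun p _ => (p : ℕ)) ?_ ?_ ?_ ?_
  · intro p hp
    have := p.le_m
    simp at hp ⊢
    omega
  · intro p _ q _ h
    exact Subtype.ext h
  · intro i hi
    have hi' := Finset.mem_Icc.1 hi
    exact ⟨⟨i, Finset.mem_Icc.2 ⟨by omega, hi'.2⟩⟩, by simp; omega, rfl⟩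
  · intro p _
    rfl

variable {S}

/-- Coordinates beyond `n` lie in the block of `k` or later, where the fields contain `A_k`. -/
theorem smul_mem_tail {k : S.Idx} {n : ℕ} (hn : S.s (S.block k - 1) ≤ n) {c : K} (hc : c ∈ S.A k)
    {x : S.Idx → K} (hx : x ∈ S.tail n) : c • x ∈ S.tail n := by
  rw [mem_tail] at hx ⊢
  refine ⟨fun p => ?_, fun p hp => by simp [hx.2 p hp]⟩
  by_cases hp : (p : ℕ) ≤ n
  · simp [hx.2 p hp, (S.A p).zero_mem]
  · refine (S.A p).mul_mem (Idx.A_mono (i := k) (p := p) ?_ hc) (hx.1 p)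
    have h : ¬ S.block p ≤ S.block k - 1 := by
      rw [S.block_le_iff p.le_m]
      omega
    omega

theorem single_mem_points {p : S.Idx} {a : K} (ha : a ∈ S.A p) :
    (Pi.single p a : S.Idx → K) ∈ S.points := fun i => by
  by_cases h : i = p
  · subst h
    simpa using ha
  · simp [h, (S.A i).zero_mem]

variable (S)

/-- The points of `𝒜` that agree with the line `A_k e_k` in the first `n` coordinates. -/
theorem adjoinLine_single_tail {n : ℕ} {k : S.Idx} (hk : (k : ℕ) ≤ n) :
    AddSubgroup.adjoinLine (S.A k) (Pi.single k 1 : S.Idx → K) (S.tail n) =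
      S.vanishOn (Finset.univ.filter fun p : S.Idx => (p : ℕ) ≤ n ∧ p ≠ k) := by
  ext x
  simp only [AddSubgroup.mem_adjoinLine, mem_vanishOn, Finset.mem_filter, Finset.mem_univ,
    true_and]
  constructor
  · rintro ⟨c, hc, w, hw, rfl⟩
    rw [mem_tail] at hw
    refine ⟨fun p => ?_, fun p hp => by simp [hp.2, hw.2 p hp.1]⟩
    by_cases h : p = k
    · subst h
      simpa using (S.A p).add_mem hc (hw.1 p)
    · simpa [h] using hw.1 p
  · rintro ⟨hx, hx0⟩
    refine ⟨x k, hx k, x - x k • Pi.single k 1, ?_, by abel⟩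
    rw [mem_tail]
    refine ⟨fun p => ?_, fun p hp => ?_⟩
    · by_cases h : p = k
      · subst h
        simp
      · simpa [h] using hx p
    · by_cases h : p = k
      · subst h
        simp
      · simp [h, hx0 p ⟨hp, h⟩]

/-! ### Linear automorphisms preserving `𝒜` -/

section linGroup

variable [Finite K]

/-- The linear automorphisms of `K ^ m` that preserve `𝒜`. -/
def linGroup : Subgroup ((S.Idx → K) ≃ₗ[K] (S.Idx → K)) where
  carrier := {g | ∀ x ∈ S.points, g x ∈ S.points}
  one_mem' := fun _ hx => hx
  mul_mem' := fun hg hg' x hx => hg _ (hg' x hx)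
  inv_mem' := by
    intro g hg x hx
    have h : g '' S.points = S.points := Set.eq_of_subset_of_ncard_le (Set.image_subset_iff.2 hg)
      (Set.ncard_image_of_injective _ g.injective).ge
    obtain ⟨y, hy, rfl⟩ := h.ge hx
    change g.symm (g y) ∈ _
    rwa [LinearEquiv.symm_apply_apply]

variable {S}

theorem symm_mem_points {g : (S.Idx → K) ≃ₗ[K] (S.Idx → K)} (hg : g ∈ S.linGroup)
    {x : S.Idx → K} (hx : x ∈ S.points) : g.symm x ∈ S.points :=
  S.linGroup.inv_mem hg x hx

/-- If the entry `c` were nonzero, then `c` and `a c` would lie in `A_i` for all `a ∈ A_p`, forcing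
`A_p ≤ A_i` against the strictness of the chain. Hence these automorphisms are block triangular and
preserve the flag. -/
theorem apply_single_eq_zero {g : (S.Idx → K) ≃ₗ[K] (S.Idx → K)} (hg : g ∈ S.linGroup)
    {p i : S.Idx} (h : S.block i < S.block p) : g (Pi.single p 1) i = 0 := by
  by_contra h0
  refine absurd (S.block_le_of_A_le p.one_le i.one_le p.le_m i.le_m ?_) (not_le_of_gt h)
  intro a ha
  have h1 := hg _ (single_mem_points (p := p) (S.A p).one_mem) i
  have h2 := hg _ (single_mem_points (p := p) ha) i
  have h3 : (Pi.single p a : S.Idx → K) = a • Pi.single p 1 := by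
    rw [← Pi.single_smul, smul_eq_mul, mul_one]
  rw [h3, map_smul, Pi.smul_apply, smul_eq_mul] at h2
  have := (S.A i).mul_mem h2 ((S.A i).inv_mem h1)
  rwa [mul_inv_cancel_right₀ h0] at this

theorem map_mem_tail {g : (S.Idx → K) ≃ₗ[K] (S.Idx → K)} (hg : g ∈ S.linGroup) {t : ℕ}
    {x : S.Idx → K} (hx : x ∈ S.tail (S.s t)) : g x ∈ S.tail (S.s t) := by
  rw [mem_tail] at hx ⊢
  refine ⟨hg x hx.1, fun i hi => ?_⟩
  have hsum : x = ∑ p, x p • (Pi.single p 1 : S.Idx → K) := by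
    rw [pi_eq_sum_univ' x]
    refine Finset.sum_congr rfl fun p _ => ?_
    ext q
    simp [Pi.single_apply, eq_comm]
  rw [hsum, map_sum, Finset.sum_apply]
  refine Finset.sum_eq_zero fun p _ => ?_
  rw [map_smul, Pi.smul_apply, smul_eq_mul]
  by_cases hp : (p : ℕ) ≤ S.s t
  · rw [hx.2 p hp, zero_mul]
  · rw [apply_single_eq_zero hg, mul_zero]
    rw [← S.block_le_iff i.le_m] at hi
    rw [← S.block_le_iff p.le_m] at hp
    omega

theorem map_mem_tail_iff {g : (S.Idx → K) ≃ₗ[K] (S.Idx → K)} (hg : g ∈ S.linGroup) {t : ℕ}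
    {x : S.Idx → K} : g x ∈ S.tail (S.s t) ↔ x ∈ S.tail (S.s t) := by
  refine ⟨fun h => ?_, map_mem_tail hg⟩
  have := map_mem_tail (S.linGroup.inv_mem hg) h
  change g.symm (g x) ∈ _ at this
  rwa [LinearEquiv.symm_apply_apply] at this

/-- Every point in block `t` outside `tail (s t)` is the image of `e_k`. -/
theorem exists_apply_single_eq {k : S.Idx} {v : S.Idx → K}
    (hv : v ∈ S.tail (S.s (S.block k - 1))) (hv' : v ∉ S.tail (S.s (S.block k))) :
    ∃ g ∈ S.linGroup, g (Pi.single k 1) = v ∧ ∀ x ∈ S.tail (S.s (S.block k)), g x = x := by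
  classical
  rw [mem_tail] at hv hv'
  obtain ⟨k', hk', hvk'⟩ : ∃ p : S.Idx, (p : ℕ) ≤ S.s (S.block k) ∧ v p ≠ 0 := by
    by_contra h
    push Not at h
    exact hv' ⟨hv.1, h⟩
  have hblock : S.block k' = S.block k := by
    rw [← S.block_le_iff k'.le_m] at hk'
    have h2 : ¬ S.block k' ≤ S.block k - 1 := fun h => hvk' (hv.2 k' ((S.block_le_iff k'.le_m).1 h))
    omega
  have hA : S.A k' = S.A k := by unfold A; rw [hblock]
  -- First `e_k` is moved to `e_{k'}`, where `v` has a nonzero coordinate; then `g₂` sends `e_{k'}`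
  -- to `v` and fixes the hyperplane `x_{k'} = 0`.
  let g₁ : (S.Idx → K) ≃ₗ[K] (S.Idx → K) := LinearEquiv.funCongrLeft K K (Equiv.swap k k')
  let ψ : (S.Idx → K) →ₗ[K] (S.Idx → K) :=
    (LinearMap.proj k').smulRight (v - Pi.single k' 1)
  have hψ : ∀ x, ψ x = x k' • (v - Pi.single k' 1) := fun x => rfl
  let g₂ : (S.Idx → K) ≃ₗ[K] (S.Idx → K) :=
    -- The inverse comes from `ψ² = (v k' - 1) ψ`.
    LinearEquiv.ofLinearMap (LinearMap.id + ψ) (LinearMap.id - (v k')⁻¹ • ψ)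
      (by
        refine LinearMap.ext fun x => funext fun i => ?_
        simp [hψ]
        field_simp
        ring)
      (by
        refine LinearMap.ext fun x => funext fun i => ?_
        simp [hψ]
        field_simp
        ring)
  have hg₂ : ∀ x, g₂ x = x + x k' • (v - Pi.single k' 1) := fun x => rfl
  have hg₁ : ∀ x i, g₁ x i = x (Equiv.swap k k' i) := fun x i => rfl
  have m₁ : g₁ ∈ S.linGroup := by
    intro x hx i
    rw [hg₁, Equiv.swap_apply_def]
    split_ifs with h1 h2
    · rw [h1, ← hA]; exact hx k'
    · rw [h2, hA]; exact hx k
    · exact hx i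
  have m₂ : g₂ ∈ S.linGroup := by
    intro x hx
    rw [hg₂]
    rw [← mem_tail_zero]
    refine (S.tail 0).add_mem (mem_tail_zero.2 hx)
      (S.tail_anti (Nat.zero_le (S.s (S.block k' - 1))) (smul_mem_tail (k := k') le_rfl (hx k') ?_))
    refine (S.tail _).sub_mem (by rwa [hblock, mem_tail]) ?_
    rw [mem_tail]
    refine ⟨single_mem_points (S.A k').one_mem, fun p hp => ?_⟩
    rw [← S.block_le_iff p.le_m] at hp
    have h1 := S.block_spec k'.one_le k'.le_m
    have : p ≠ k' := by rintro rfl; omega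
    simp [this]
  refine ⟨g₂ * g₁, S.linGroup.mul_mem m₂ m₁, ?_, ?_⟩
  · have : g₁ (Pi.single k 1) = Pi.single k' 1 := by
      ext i
      rw [hg₁]
      simp only [Pi.single_apply]
      congr 1
      rw [Equiv.swap_apply_eq_iff, Equiv.swap_apply_left]
    change g₂ (g₁ _) = v
    rw [this, hg₂]
    simp
  · intro x hx
    rw [mem_tail] at hx
    have h1 : x k = 0 := hx.2 k ((S.block_le_iff k.le_m).1 le_rfl)
    have h2 : x k' = 0 := hx.2 k' hk'
    have : g₁ x = x := by
      ext i
      rw [hg₁, Equiv.swap_apply_def]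
      split_ifs with h3 h4
      · rw [h3, h1, h2]
      · rw [h4, h1, h2]
      · rfl
    change g₂ (g₁ x) = x
    rw [this, hg₂, h2]
    simp

/-- The automorphism of `K ^ m` that acts on the coordinates in block `r` by a matrix over `F_r`. -/
theorem exists_block_extension {r : ℕ} {q : S.Idx} (hq : S.block q = r)
    (e : ({p : S.Idx // S.block p = r} → S.A q) ≃ₗ[S.A q] ({p : S.Idx // S.block p = r} → S.A q)) :
    ∃ g ∈ S.linGroup, ∀ (x : S.Idx → K) (y : {p : S.Idx // S.block p = r} → S.A q), (∀ p, x p.1 = y p) →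
        ∀ p, g x p.1 = e y p := by
  classical
  let B := {p : S.Idx // S.block p = r}
  -- Extension of scalars from `F_r` to `K`: the same matrix is read over `K`.
  let E : ((B → S.A q) →ₗ[S.A q] (B → S.A q)) → (B → K) →ₗ[K] (B → K) := fun f =>
    Matrix.toLin' ((LinearMap.toMatrix' f).map (algebraMap (S.A q) K))
  have hE : ∀ f f', E f ∘ₗ E f' = E (f ∘ₗ f') := by
    intro f f'
    simp only [E]
    rw [← Matrix.toLin'_mul, LinearMap.toMatrix'_comp, Matrix.map_mul]
  have hE1 : E LinearMap.id = LinearMap.id := by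
    simp only [E]
    rw [LinearMap.toMatrix'_id, Matrix.map_one _ (map_zero _) (map_one _), Matrix.toLin'_one]
  have hEy : ∀ f y p, E f (fun i => ((y i : S.A q) : K)) p = f y p := by
    intro f y p
    simp only [E, Matrix.toLin'_apply]
    have := RingHom.map_mulVec (algebraMap (S.A q) K) (LinearMap.toMatrix' f) y p
    rw [LinearMap.toMatrix'_mulVec] at this
    exact this.symm
  let G : ((B → K) →ₗ[K] (B → K)) → (S.Idx → K) →ₗ[K] (S.Idx → K) := fun T =>
    { toFun := fun x p => if h : S.block p = r then T (fun b => x b.1) ⟨p, h⟩ else x p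
      map_add' := by
        intro x y
        ext p
        by_cases h : S.block p = r
        · simp only [h, dif_pos, Pi.add_apply]
          rw [← Pi.add_apply, ← map_add]
          rfl
        · simp [h]
      map_smul' := by
        intro c x
        ext p
        by_cases h : S.block p = r
        · simp only [h, dif_pos, Pi.smul_apply, RingHom.id_apply]
          rw [← Pi.smul_apply, ← map_smul]
          rfl
        · simp [h] }
  have hGb : ∀ T x (b : B), G T x b.1 = T (fun b => x b.1) b := fun T x b => dif_pos b.2
  have hGn : ∀ T x (p : S.Idx), S.block p ≠ r → G T x p = x p := fun T x p h => dif_neg h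
  have hG : ∀ f f', f ∘ₗ f' = LinearMap.id → G (E f) ∘ₗ G (E f') = LinearMap.id := by
    intro f f' h
    refine LinearMap.ext fun x => funext fun p => ?_
    by_cases hp : S.block p = r
    · have h1 := hGb (E f) (G (E f') x) ⟨p, hp⟩
      simp only [hGb] at h1
      change G (E f) (G (E f') x) p = x p
      rw [h1]
      change (E f ∘ₗ E f') (fun b => x b.1) ⟨p, hp⟩ = x p
      rw [hE, h, hE1]
      rfl
    · change G (E f) (G (E f') x) p = x p
      rw [hGn _ _ _ hp, hGn _ _ _ hp]
  let g : (S.Idx → K) ≃ₗ[K] (S.Idx → K) := LinearEquiv.ofLinearMap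
    (G (E e)) (G (E e.symm)) (hG _ _ (by ext; simp)) (hG _ _ (by ext; simp))
  have key : ∀ (x : S.Idx → K) (y : B → S.A q), (∀ p : B, x p.1 = y p) → ∀ p : B, g x p.1 = e y p := by
    intro x y hxy p
    change G (E e) x p.1 = _
    rw [hGb, show (fun b : B => x b.1) = fun b => (y b : K) from funext hxy, hEy]
    rfl
  refine ⟨g, ?_, key⟩
  have hA : ∀ p : B, S.A p.1 = S.A q := fun p => by
    unfold A
    rw [p.2, hq]
  intro x hx p
  by_cases hp : S.block p = r
  · have := key x (fun b => ⟨x b.1, hA b ▸ hx b.1⟩) (fun _ => rfl) ⟨p, hp⟩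
    rw [this, show S.A p = S.A q from hA ⟨p, hp⟩]
    exact Subtype.property _
  · have : g x p = x p := hGn _ x p hp
    rw [this]
    exact hx p

end linGroup

end NestedSubfields

/-! ### Orbits of tails as subspaces of one block -/

namespace NestedSubfields

variable {K : Type*} [Field K] {S : NestedSubfields K}

theorem natCard_block {r : ℕ} (h1 : 1 ≤ r) (hr : r ≤ S.lam) :
    Nat.card {p : S.Idx // S.block p = r} = S.μ r := by
  have e : {p : S.Idx // S.block p = r} ≃ Finset.Ioc (S.s (r - 1)) (S.s r) :=
    { toFun := fun p => ⟨p.1, Finset.mem_Ioc.2 ((S.block_eq_iff p.1.le_m h1).1 p.2)⟩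
      invFun := fun p =>
        have hp := Finset.mem_Ioc.1 p.2
        have hm : (p : ℕ) ≤ S.m := hp.2.trans (S.s_mono hr)
        ⟨⟨p, Finset.mem_Icc.2 ⟨by omega, hm⟩⟩, (S.block_eq_iff hm h1).2 hp⟩
      left_inv := fun p => rfl
      right_inv := fun p => rfl }
  rw [Nat.card_congr e, Nat.card_eq_fintype_card, Fintype.card_coe]
  have := S.s_succ (r - 1)
  rw [Nat.sub_add_cancel h1] at this
  simp
  omega

/-- The coordinates in the block of `q`. -/
abbrev BlockIdx (q : S.Idx) : Type := {p : S.Idx // S.block p = S.block q}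

theorem BlockIdx.A_eq {q : S.Idx} (p : BlockIdx q) : S.A p.1 = S.A q := by
  unfold A
  rw [p.2]

theorem BlockIdx.mem_A_iff {q : S.Idx} (p : BlockIdx q) {a : K} : a ∈ S.A p.1 ↔ a ∈ S.A q := by
  rw [p.A_eq]

open Classical in
/-- Extension by zero from the block of `q` to all coordinates. -/
noncomputable def extendBlock (q : S.Idx) : (BlockIdx q → S.A q) →ₗ[S.A q] (S.Idx → K) where
  toFun y p := if h : S.block p = S.block q then (y ⟨p, h⟩ : K) else 0
  map_add' y y' := by
    ext p
    by_cases h : S.block p = S.block q <;> simp [h]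
  map_smul' c y := by
    ext p
    by_cases h : S.block p = S.block q
    · simp [h, Subfield.smul_def]
    · simp [h]

theorem extendBlock_apply {q : S.Idx} (y : BlockIdx q → S.A q) (p : BlockIdx q) :
    extendBlock q y p.1 = y p := dif_pos p.2

theorem extendBlock_apply_of_ne {q : S.Idx} (y : BlockIdx q → S.A q) {p : S.Idx}
    (h : S.block p ≠ S.block q) : extendBlock q y p = 0 := dif_neg h

theorem extendBlock_mem_tail {q : S.Idx} (y : BlockIdx q → S.A q) :
    extendBlock q y ∈ S.tail (S.s (S.block q - 1)) := by
  rw [mem_tail]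
  refine ⟨fun p => ?_, fun p hp => ?_⟩
  · by_cases h : S.block p = S.block q
    · rw [extendBlock_apply y ⟨p, h⟩, BlockIdx.mem_A_iff ⟨p, h⟩]
      exact Subtype.property _
    · rw [extendBlock_apply_of_ne y h]
      exact (S.A p).zero_mem
  · apply extendBlock_apply_of_ne
    rw [← S.block_le_iff p.le_m] at hp
    have := S.block_spec q.one_le q.le_m
    omega

/-- Two points with zeros before the block of `q` that agree on it differ by zeros up to it. -/
theorem sub_mem_tail {q : S.Idx} {x x' : S.Idx → K} (hx : x ∈ S.tail (S.s (S.block q - 1)))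
    (hx' : x' ∈ S.tail (S.s (S.block q - 1))) (h : ∀ p : BlockIdx q, x p.1 = x' p.1) :
    x - x' ∈ S.tail (S.s (S.block q)) := by
  rw [mem_tail]
  refine ⟨(mem_tail.1 ((S.tail _).sub_mem hx hx')).1, fun p hp => ?_⟩
  rw [Pi.sub_apply, sub_eq_zero]
  by_cases hpq : S.block p = S.block q
  · exact h ⟨p, hpq⟩
  · rw [← S.block_le_iff p.le_m] at hp
    have : (p : ℕ) ≤ S.s (S.block q - 1) := by
      rw [← S.block_le_iff p.le_m]
      omega
    rw [(mem_tail.1 hx).2 p this, (mem_tail.1 hx').2 p this]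

/-- The points whose coordinates vanish before the block of `q` and form, on it, a vector of `U`. -/
def liftSubmodule (q : S.Idx) (U : Submodule (S.A q) (BlockIdx q → S.A q)) :
    AddSubgroup (S.Idx → K) where
  carrier := {x | x ∈ S.tail (S.s (S.block q - 1)) ∧ ∃ y ∈ U, ∀ p, x p.1 = y p}
  zero_mem' := ⟨(S.tail _).zero_mem, 0, U.zero_mem, fun _ => rfl⟩
  add_mem' := by
    rintro x x' ⟨hx, y, hy, h⟩ ⟨hx', y', hy', h'⟩
    exact ⟨(S.tail _).add_mem hx hx', y + y', U.add_mem hy hy', fun p => by simp [h, h']⟩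
  neg_mem' := by
    rintro x ⟨hx, y, hy, h⟩
    exact ⟨(S.tail _).neg_mem hx, -y, U.neg_mem hy, fun p => by simp [h]⟩

theorem mem_liftSubmodule {q : S.Idx} {U : Submodule (S.A q) (BlockIdx q → S.A q)}
    {x : S.Idx → K} : x ∈ liftSubmodule q U ↔
      x ∈ S.tail (S.s (S.block q - 1)) ∧ ∃ y ∈ U, ∀ p, x p.1 = y p := Iff.rfl

theorem extendBlock_mem_liftSubmodule {q : S.Idx} {U : Submodule (S.A q) (BlockIdx q → S.A q)}
    {y : BlockIdx q → S.A q} : extendBlock q y ∈ liftSubmodule q U ↔ y ∈ U := by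
  refine ⟨fun ⟨_, y', hy', h⟩ => ?_, fun hy => ⟨extendBlock_mem_tail y, y, hy,
    extendBlock_apply y⟩⟩
  have : y = y' := funext fun p => Subtype.ext (by rw [← h, extendBlock_apply])
  rwa [this]

theorem liftSubmodule_injective (q : S.Idx) : Function.Injective (liftSubmodule (S := S) q) :=
  fun U U' h => by
    ext y
    rw [← extendBlock_mem_liftSubmodule, h, extendBlock_mem_liftSubmodule]

theorem tail_le_tail_pred (q : S.Idx) :
    S.tail (S.s (S.block q)) ≤ S.tail (S.s (S.block q - 1)) :=
  S.tail_anti (S.s_mono (Nat.sub_le _ _))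

theorem ncard_liftSubmodule (q : S.Idx) (U : Submodule (S.A q) (BlockIdx q → S.A q)) :
    (liftSubmodule q U : Set (S.Idx → K)).ncard =
      Nat.card U * (S.tail (S.s (S.block q)) : Set (S.Idx → K)).ncard := by
  have e : (U × S.tail (S.s (S.block q))) ≃ liftSubmodule q U := by
    refine Equiv.ofBijective (fun a => ⟨extendBlock q a.1.1 + a.2.1, ?_⟩) ⟨?_, ?_⟩
    · obtain ⟨⟨y, hy⟩, z, hz⟩ := a
      refine (liftSubmodule q U).add_mem (extendBlock_mem_liftSubmodule.2 hy)
        ⟨tail_le_tail_pred q hz, 0, U.zero_mem, fun p => ?_⟩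
      exact (mem_tail.1 hz).2 _ (by rw [← S.block_le_iff p.1.le_m, p.2])
    · rintro ⟨⟨y, hy⟩, z, hz⟩ ⟨⟨y', hy'⟩, z', hz'⟩ h
      simp only [Subtype.mk.injEq] at h
      have hyy : y = y' := by
        ext p
        have := congrFun h p.1
        have hp : (p.1 : ℕ) ≤ S.s (S.block q) := by rw [← S.block_le_iff p.1.le_m, p.2]
        rw [Pi.add_apply, Pi.add_apply, extendBlock_apply, extendBlock_apply,
          (mem_tail.1 hz).2 _ hp, (mem_tail.1 hz').2 _ hp] at this
        simpa using this
      subst hyy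
      simpa using h
    · rintro ⟨x, hx, y, hy, h⟩
      refine ⟨⟨⟨y, hy⟩, x - extendBlock q y, sub_mem_tail hx (extendBlock_mem_tail y) fun p => ?_⟩,
        ?_⟩
      · rw [h, extendBlock_apply]
      · simp
  change Nat.card (liftSubmodule q U) = _ * Nat.card (S.tail (S.s (S.block q)))
  rw [← Nat.card_congr e, Nat.card_prod]

theorem ncard_tail_eq_mul {a b : ℕ} (hab : a ≤ b) (hb : b ≤ S.m) :
    (S.tail a : Set (S.Idx → K)).ncard =
      (∏ i ∈ Finset.Icc (a + 1) b, S.d i) * (S.tail b : Set (S.Idx → K)).ncard := by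
  rw [ncard_tail, ncard_tail, ← Finset.Ico_add_one_right_eq_Icc, ← Finset.Ico_add_one_right_eq_Icc,
    ← Finset.Ico_add_one_right_eq_Icc,
    Finset.prod_Ico_consecutive _ (by omega) (by omega)]

theorem prod_d_block {q : S.Idx} {n : ℕ} (hn : S.s (S.block q - 1) ≤ n) :
    ∏ i ∈ Finset.Icc (n + 1) (S.s (S.block q)), S.d i = S.d q ^ (S.s (S.block q) - n) := by
  have hq := S.block_spec q.one_le q.le_m
  rw [Finset.prod_congr rfl (g := fun _ => S.d q), Finset.prod_const, Nat.card_Icc]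
  · congr 1
    omega
  · intro i hi
    rw [Finset.mem_Icc] at hi
    exact S.d_eq_of_block_eq
      ((S.block_eq_iff (hi.2.trans (S.s_mono hq.2.1)) hq.1).2 ⟨by omega, hi.2⟩)

theorem s_block_le_m (q : S.Idx) : S.s (S.block q) ≤ S.m :=
  S.s_mono (S.block_spec q.one_le q.le_m).2.1

theorem ncard_map (g : (S.Idx → K) ≃ₗ[K] (S.Idx → K)) (H : AddSubgroup (S.Idx → K)) :
    (H.map (g : (S.Idx → K) →+ (S.Idx → K)) : Set (S.Idx → K)).ncard =
      (H : Set (S.Idx → K)).ncard := by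
  rw [AddSubgroup.coe_map]
  exact Set.ncard_image_of_injective _ g.injective

/-- The quotient of the two bounding tails is the coordinate space of the block over `A_q`, so a
stable `W` between them is the preimage of a subspace. -/
theorem exists_liftSubmodule_eq {q : S.Idx} {W : AddSubgroup (S.Idx → K)}
    (h1 : S.tail (S.s (S.block q)) ≤ W) (h2 : W ≤ S.tail (S.s (S.block q - 1)))
    (h3 : ∀ c ∈ S.A q, ∀ x ∈ W, c • x ∈ W) : ∃ U, W = liftSubmodule q U := by
  refine ⟨{ carrier := {y | extendBlock q y ∈ W}
            zero_mem' := by simp [W.zero_mem]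
            add_mem' := fun {y y'} hy hy' => by
              simpa only [Set.mem_ofPred_eq, map_add] using W.add_mem hy hy'
            smul_mem' := fun c y hy => by
              rw [Set.mem_ofPred_eq, map_smul]
              exact h3 c c.2 _ hy }, ?_⟩
  ext x
  rw [mem_liftSubmodule]
  constructor
  · intro hx
    have hx' := h2 hx
    let y : BlockIdx q → S.A q := fun p => ⟨x p.1, p.mem_A_iff.1 ((mem_tail.1 hx').1 p.1)⟩
    refine ⟨hx', y, ?_, fun p => rfl⟩
    have := h1 (sub_mem_tail (extendBlock_mem_tail y) hx' fun p => extendBlock_apply y p)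
    have := W.add_mem this hx
    rwa [sub_add_cancel] at this
  · rintro ⟨hx, y, hy, h⟩
    have := h1 (sub_mem_tail hx (extendBlock_mem_tail y) fun p => by rw [h, extendBlock_apply])
    have := W.add_mem this hy
    rwa [sub_add_cancel] at this

section Finite

variable [Finite K]

theorem ncard_tail_pos (n : ℕ) : 0 < (S.tail n : Set (S.Idx → K)).ncard :=
  (Set.ncard_pos (Set.toFinite _)).2 ⟨0, (S.tail n).zero_mem⟩

theorem one_lt_d (i : ℕ) : 1 < S.d i := Finite.one_lt_card

theorem finrank_eq_of_ncard {q : S.Idx} {n : ℕ} (hn : S.s (S.block q - 1) ≤ n)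
    (hn' : n ≤ S.s (S.block q)) {U : Submodule (S.A q) (BlockIdx q → S.A q)} :
    (liftSubmodule q U : Set (S.Idx → K)).ncard = (S.tail n : Set (S.Idx → K)).ncard ↔
      Module.finrank (S.A q) U = S.s (S.block q) - n := by
  rw [ncard_liftSubmodule, ncard_tail_eq_mul hn' (s_block_le_m q), prod_d_block hn,
    Nat.mul_left_inj (ncard_tail_pos _).ne', Module.natCard_eq_pow_finrank (K := S.A q)]
  exact Nat.pow_right_inj (one_lt_d (S := S) q)

variable (S) in
/-- The images of `tail n` under the linear automorphisms that preserve `𝒜`. -/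
def tailOrbit (n : ℕ) : Set (AddSubgroup (S.Idx → K)) :=
  {W | ∃ g ∈ S.linGroup, W = (S.tail n).map (g : (S.Idx → K) →+ (S.Idx → K))}

theorem smul_mem_of_mem_tailOrbit {k : S.Idx} {n : ℕ} (hn : S.s (S.block k - 1) ≤ n)
    {W : AddSubgroup (S.Idx → K)} (hW : W ∈ S.tailOrbit n) :
    ∀ c ∈ S.A k, ∀ x ∈ W, c • x ∈ W := by
  obtain ⟨g, hg, rfl⟩ := hW
  rintro c hc _ ⟨x, hx, rfl⟩
  exact ⟨c • x, smul_mem_tail hn hc hx, map_smul g c x⟩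

theorem le_tail_of_mem_tailOrbit {n t : ℕ} (h : S.s t ≤ n) {W : AddSubgroup (S.Idx → K)}
    (hW : W ∈ S.tailOrbit n) : W ≤ S.tail (S.s t) := by
  obtain ⟨g, hg, rfl⟩ := hW
  rintro _ ⟨x, hx, rfl⟩
  exact map_mem_tail hg (S.tail_anti h hx)

theorem tail_le_of_mem_tailOrbit {n t : ℕ} (h : n ≤ S.s t) {W : AddSubgroup (S.Idx → K)}
    (hW : W ∈ S.tailOrbit n) : S.tail (S.s t) ≤ W := by
  obtain ⟨g, hg, rfl⟩ := hW
  intro x hx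
  refine ⟨g.symm x, S.tail_anti h ((map_mem_tail_iff hg).1 ?_), g.apply_symm_apply x⟩
  rwa [LinearEquiv.apply_symm_apply]

/-- The general linear group of the block is transitive on subspaces of a given dimension, and its
elements extend to automorphisms preserving `𝒜`. Conversely, the dimension is read off from the
cardinality, which automorphisms preserve. -/
theorem tailOrbit_eq {q : S.Idx} {n : ℕ} (hn : S.s (S.block q - 1) ≤ n)
    (hn' : n ≤ S.s (S.block q)) :
    S.tailOrbit n = liftSubmodule q ''
      {U | Module.finrank (S.A q) U = S.s (S.block q) - n} := by
  ext W
  constructor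
  · intro hW
    obtain ⟨U, rfl⟩ := exists_liftSubmodule_eq (q := q) (tail_le_of_mem_tailOrbit hn' hW)
      (le_tail_of_mem_tailOrbit hn hW) (smul_mem_of_mem_tailOrbit hn hW)
    refine ⟨U, ?_, rfl⟩
    obtain ⟨g, hg, h⟩ := hW
    rw [Set.mem_ofPred_eq, ← finrank_eq_of_ncard hn hn', h, ncard_map]
  · rintro ⟨U, hU, rfl⟩
    obtain ⟨U₀, hU₀⟩ := exists_liftSubmodule_eq (q := q) (S.tail_anti hn') (S.tail_anti hn)
      (fun c hc x hx => smul_mem_tail hn hc hx)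
    have hfin : Module.finrank (S.A q) U₀ = S.s (S.block q) - n := by
      rw [← finrank_eq_of_ncard hn hn', ← hU₀]
    obtain ⟨e, he⟩ := Submodule.exists_linearEquiv_map_eq U₀ U (hfin.trans hU.symm)
    obtain ⟨g, hg, hgy⟩ := exists_block_extension (q := q) rfl e
    refine ⟨g, hg, ?_⟩
    symm
    apply SetLike.coe_injective
    refine Set.eq_of_subset_of_ncard_le ?_ ?_
    · rw [hU₀]
      rintro _ ⟨x, ⟨hx, y, hy, h⟩, rfl⟩
      refine ⟨map_mem_tail hg hx, e y, ?_, hgy x y h⟩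
      rw [← he]
      exact Submodule.mem_map_of_mem hy
    · rw [ncard_map, (finrank_eq_of_ncard hn hn').2 hU]

theorem ncard_tailOrbit {q : S.Idx} {n : ℕ} (hn : S.s (S.block q - 1) ≤ n)
    (hn' : n ≤ S.s (S.block q)) :
    (S.tailOrbit n).ncard =
      qBinom (S.A q) (S.μ (S.block q)) (n - S.s (S.block q - 1)) := by
  have hq := S.block_spec q.one_le q.le_m
  have hs := S.s_succ (S.block q - 1)
  rw [Nat.sub_add_cancel hq.1] at hs
  rw [tailOrbit_eq hn hn', Set.ncard_image_of_injective _ (liftSubmodule_injective q),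
    ← qBinom_symm (S.A q) (by omega)]
  have e : Fin (S.μ (S.block q)) ≃ BlockIdx q :=
    (Finite.equivFinOfCardEq (natCard_block hq.1 hq.2.1)).symm
  have h1 : S.s (S.block q) - n = S.μ (S.block q) - (n - S.s (S.block q - 1)) := by omega
  rw [h1]
  exact natCard_submodule_finrank_eq (LinearEquiv.funCongrLeft (S.A q) (S.A q) e) _

end Finite

end NestedSubfields

/-! ### From codewords to cosets of linear images -/

namespace NestedSubfields

variable {K : Type*} [Field K] {S : NestedSubfields K}

/-- The bounds `0 < l ≤ d (j + 1) - 1` place `u` in disjoint intervals between consecutive partial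
sums. -/
theorem IsDecomp.unique {u j l j' l' : ℕ} (h : S.IsDecomp u j l) (h' : S.IsDecomp u j' l') :
    j = j' ∧ l = l' := by
  have key : ∀ a b : ℕ, a < b → (∑ i ∈ Finset.Icc 1 a, (S.d i - 1)) + (S.d (a + 1) - 1) ≤
      ∑ i ∈ Finset.Icc 1 b, (S.d i - 1) := by
    intro a b hab
    rw [← Finset.sum_Icc_succ_top (by omega)]
    exact Finset.sum_le_sum_of_subset (Finset.Icc_subset_Icc le_rfl hab)
  obtain ⟨-, h1, h2, h3⟩ := h
  obtain ⟨-, h1', h2', h3'⟩ := h'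
  have hj : j = j' := by
    rcases lt_trichotomy j j' with hlt | heq | hlt
    · have := key _ _ hlt
      omega
    · exact heq
    · have := key _ _ hlt
      omega
  subst hj
  exact ⟨rfl, by omega⟩

variable (S) in
/-- The points of `𝒜` whose coordinates up to `n`, other than the one at `k`, vanish. -/
def zeroSet (n : ℕ) (k : S.Idx) : AddSubgroup (S.Idx → K) :=
  S.vanishOn (Finset.univ.filter fun p : S.Idx => (p : ℕ) ≤ n ∧ p ≠ k)

theorem ncard_zeroSet {k : S.Idx} {n : ℕ} (hk : (k : ℕ) ≤ n) (hn : n ≤ S.m) :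
    (∏ i ∈ (Finset.Icc 1 n).erase (k : ℕ), S.d i) * (S.zeroSet n k : Set (S.Idx → K)).ncard =
      (S.tail 0 : Set (S.Idx → K)).ncard := by
  have hz : (S.zeroSet n k : Set (S.Idx → K)).ncard =
      ∏ i ∈ insert (k : ℕ) (Finset.Icc (n + 1) S.m), S.d i := by
    rw [zeroSet, ncard_vanishOn]
    have := k.one_le
    have := k.le_m
    refine Finset.prod_bij (fun p _ => (p : ℕ)) ?_ ?_ ?_ ?_
    · intro p hp
      have := p.le_m
      have hpk : p = k ↔ (p : ℕ) = k := Subtype.ext_iff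
      simp only [Finset.mem_compl, Finset.mem_filter, Finset.mem_univ, true_and, ne_eq, hpk,
        Finset.mem_insert, Finset.mem_Icc] at hp ⊢
      omega
    · intro p _ q _ h
      exact Subtype.ext h
    · intro i hi
      rw [Finset.mem_insert, Finset.mem_Icc] at hi
      refine ⟨⟨i, Finset.mem_Icc.2 (by omega)⟩, ?_, rfl⟩
      simp only [Finset.mem_compl, Finset.mem_filter, Finset.mem_univ, true_and, ne_eq,
        ← Subtype.coe_inj]
      omega
    · intro p _
      rfl
  rw [hz, Finset.prod_insert (by simp; omega), ← mul_assoc,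
    Finset.prod_erase_mul _ _ (Finset.mem_Icc.2 ⟨k.one_le, hk⟩),
    ncard_tail_eq_mul (Nat.zero_le n) hn, ncard_tail]

theorem words_eq_wordsOmega_empty {u j l : ℕ} (h : S.IsDecomp u j l) {k : S.Idx}
    (hk : (k : ℕ) ≤ j + 1) (hdk : S.d k = S.d (j + 1) - l) :
    S.words u k = S.wordsOmega j k ∅ := by
  ext c
  constructor
  · rintro ⟨j', l', h', -, -, Ω, -, hΩ, hc⟩
    obtain ⟨rfl, rfl⟩ := h.unique h'
    rw [hdk, Nat.sub_self, Finset.card_eq_zero] at hΩ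
    rwa [hΩ] at hc
  · intro hc
    exact ⟨j, l, h, hk, hdk.ge, ∅, by simp, by simp [hdk], hc⟩

variable [Finite K]

-- For nonzero `x ∈ A_i` one has `x ^ (d_i - 1) = 1`, so each factor is the indicator of `x = 0` on
-- `A_i`.
open Classical in
theorem ev_h_empty (j : ℕ) (k : S.Idx) (P : S.points) :
    S.ev (S.h j k ∅) P = if (P : S.Idx → K) ∈ S.zeroSet (j + 1) k then 1 else 0 := by
  simp only [ev, h, Finset.prod_empty, mul_one, map_prod, map_sub, map_one, map_pow,
    MvPolynomial.eval_X]
  split_ifs with hP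
  · refine Finset.prod_eq_one fun i hi => ?_
    rw [hP.2 i (by simpa using hi), zero_pow, sub_zero]
    have := one_lt_d (S := S) i
    omega
  · have hP' : ¬ ∀ p ∈ Finset.univ.filter (fun p : S.Idx => (p : ℕ) ≤ j + 1 ∧ p ≠ k),
        (P : S.Idx → K) p = 0 := fun h => hP ⟨P.2, h⟩
    push Not at hP'
    obtain ⟨p, hp, hp0⟩ := hP'
    refine Finset.prod_eq_zero (i := p) (by simpa using hp) ?_
    have : Fintype (S.A p) := Fintype.ofFinite _
    have h1 := FiniteField.pow_card_sub_one_eq_one (⟨_, P.2 p⟩ : S.A p)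
      (fun h => hp0 (congrArg Subtype.val h))
    rw [← Nat.card_eq_fintype_card] at h1
    rw [sub_eq_zero]
    exact (congrArg Subtype.val h1).symm

variable (S) in
/-- The preimages of `H` under the affine group of `𝒜`. -/
def affPreimages (H : AddSubgroup (S.Idx → K)) : Set (Set (S.Idx → K)) :=
  {C | ∃ σ ∈ S.aff, C = {x | ∃ hx : x ∈ S.points, (σ ⟨x, hx⟩ : S.Idx → K) ∈ H}}

variable (S) in
/-- The images of `H` under the linear automorphisms that preserve `𝒜`. -/
def linImages (H : AddSubgroup (S.Idx → K)) : Set (AddSubgroup (S.Idx → K)) :=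
  {H' | ∃ g ∈ S.linGroup, H' = H.map (g : (S.Idx → K) →+ (S.Idx → K))}

theorem affPreimages_eq {H : AddSubgroup (S.Idx → K)} (hH : H ≤ S.tail 0) :
    S.affPreimages H =
      {C | ∃ b ∈ S.tail 0, ∃ H' ∈ S.linImages H, C = {x | x - b ∈ H'}} := by
  classical
  ext C
  constructor
  · rintro ⟨σ, ⟨⟨M, b, hσ⟩, -⟩, rfl⟩
    let g : (S.Idx → K) ≃ₗ[K] (S.Idx → K) :=
      LinearMap.GeneralLinearGroup.generalLinearEquiv K _ (Matrix.GeneralLinearGroup.toLin M)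
    have hg : ∀ x, g x = (M : Matrix S.Idx S.Idx K).mulVec x := fun x => rfl
    have hb : b ∈ S.tail 0 := by
      have := (σ ⟨0, (S.tail 0).zero_mem.1⟩).2
      rw [hσ, Matrix.mulVec_zero, zero_add] at this
      exact mem_tail_zero.2 this
    have hgl : g ∈ S.linGroup := by
      intro x hx
      have := mem_tail_zero.2 (σ ⟨x, hx⟩).2
      rw [hσ, AddSubgroup.add_mem_cancel_right _ hb, mem_tail_zero] at this
      exact this
    -- `g x + b ∈ H` holds exactly when `x + g⁻¹ b ∈ g⁻¹(H)`.
    refine ⟨-g.symm b, (S.tail 0).neg_mem (mem_tail_zero.2 (symm_mem_points hgl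
      (mem_tail_zero.1 hb))), _, ⟨g⁻¹, S.linGroup.inv_mem hgl, rfl⟩, ?_⟩
    ext x
    simp only [Set.mem_ofPred_eq, AddSubgroup.mem_map, hσ, ← hg, sub_neg_eq_add]
    constructor
    · rintro ⟨hx, h⟩
      refine ⟨_, h, ?_⟩
      change g.symm (g x + b) = _
      rw [map_add, LinearEquiv.symm_apply_apply]
    · rintro ⟨y, hy, h⟩
      change g.symm y = _ at h
      rw [LinearEquiv.symm_apply_eq, map_add, LinearEquiv.apply_symm_apply] at h
      subst h
      refine ⟨?_, hy⟩
      have := (AddSubgroup.add_mem_cancel_right _ hb).1 (hH hy)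
      have := symm_mem_points hgl (mem_tail_zero.1 this)
      rwa [LinearEquiv.symm_apply_apply] at this
  · rintro ⟨b, hb, _, ⟨g, hg, rfl⟩, rfl⟩
    -- The coset `b + g(H)` is the preimage of `H` under `x ↦ g⁻¹ (x - b)`.
    let M : GL S.Idx K := Matrix.GeneralLinearGroup.toLin.symm
      ((LinearMap.GeneralLinearGroup.generalLinearEquiv K _).symm g.symm)
    have hM : ∀ x, (M : Matrix S.Idx S.Idx K).mulVec x = g.symm x := by
      intro x
      have : LinearMap.GeneralLinearGroup.generalLinearEquiv K _
          (Matrix.GeneralLinearGroup.toLin M) = g.symm := by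
        simp only [M, MulEquiv.apply_symm_apply]
      rw [← this]
      rfl
    have hmem : ∀ x : S.points, g.symm x - g.symm b ∈ S.points := fun x =>
      mem_tail_zero.1 ((S.tail 0).sub_mem (mem_tail_zero.2 (symm_mem_points hg x.2))
        (mem_tail_zero.2 (symm_mem_points hg (mem_tail_zero.1 hb))))
    refine ⟨fun x => ⟨_, hmem x⟩, ⟨⟨M, -g.symm b, fun x => ?_⟩, ?_⟩, ?_⟩
    · rw [hM, ← sub_eq_add_neg]
    · refine Set.range_eq_univ.2 (Finite.injective_iff_surjective.1 fun x y h => ?_)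
      have := congrArg Subtype.val h
      exact Subtype.ext (by simpa using this)
    · ext x
      simp only [Set.mem_ofPred_eq, AddSubgroup.mem_map, ← map_sub]
      constructor
      · rintro ⟨y, hy, h⟩
        change g y = _ at h
        have hx : x ∈ S.points := by
          have := (S.tail 0).add_mem (mem_tail_zero.2 (hg y (hH hy).1)) hb
          rw [h, sub_add_cancel] at this
          exact mem_tail_zero.1 this
        refine ⟨hx, ?_⟩
        rwa [← h, LinearEquiv.symm_apply_apply]
      · rintro ⟨hx, h⟩
        exact ⟨_, h, g.apply_symm_apply _⟩

/-- The words in question are the nonzero multiples of indicator functions of nonempty sets. -/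
theorem ncard_wordsOmega_empty (j : ℕ) (k : S.Idx) :
    (S.wordsOmega j k ∅).ncard =
      (Nat.card K - 1) * (S.affPreimages (S.zeroSet (j + 1) k)).ncard := by
  classical
  let f : K × Set (S.Idx → K) → S.points → K := fun a P => if (P : S.Idx → K) ∈ a.2 then a.1 else 0
  have hw : S.wordsOmega j k ∅ =
      f '' ((Set.univ \ {0} : Set K) ×ˢ S.affPreimages (S.zeroSet (j + 1) k)) := by
    ext c
    have hf : ∀ γ : K, ∀ σ : S.points → S.points, ∀ P, γ * S.ev (S.h j k ∅) (σ P) =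
        f (γ, {x | ∃ hx : x ∈ S.points, (σ ⟨x, hx⟩ : S.Idx → K) ∈ S.zeroSet (j + 1) k}) P := by
      intro γ σ P
      rw [ev_h_empty]
      simp [f]
    constructor
    · rintro ⟨γ, hγ, σ, hσ, h⟩
      exact ⟨(γ, _), ⟨⟨trivial, hγ⟩, σ, hσ, rfl⟩, funext fun P => ((h P).trans (hf γ σ P)).symm⟩
    · rintro ⟨⟨γ, _⟩, ⟨⟨-, hγ⟩, σ, hσ, rfl⟩, rfl⟩
      exact ⟨γ, hγ, σ, hσ, fun P => (hf γ σ P).symm⟩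
  rw [hw, Set.InjOn.ncard_image, Set.ncard_prod,
    Set.ncard_sdiff_singleton_of_mem (Set.mem_univ _), Set.ncard_univ]
  have hsub : ∀ C ∈ S.affPreimages (S.zeroSet (j + 1) k), C ⊆ S.points := by
    rintro _ ⟨σ, hσ, rfl⟩ x ⟨hx, -⟩
    exact hx
  have hne : ∀ C ∈ S.affPreimages (S.zeroSet (j + 1) k), C.Nonempty := by
    rintro _ ⟨σ, hσ, rfl⟩
    obtain ⟨x, hx⟩ := Set.range_eq_univ.1 hσ.2 ⟨0, (S.tail 0).zero_mem.1⟩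
    refine ⟨x, x.2, ?_⟩
    rw [Subtype.coe_eta, hx]
    exact (S.zeroSet (j + 1) k).zero_mem
  rintro ⟨γ, C⟩ ⟨⟨-, hγ⟩, hC⟩ ⟨γ', C'⟩ ⟨⟨-, hγ'⟩, hC'⟩ h
  have hγ : γ ≠ 0 := hγ
  have hγ' : γ' ≠ 0 := hγ'
  have hfx : ∀ x ∈ S.points, (if x ∈ C then γ else 0) = if x ∈ C' then γ' else 0 :=
    fun x hx => congrFun h ⟨x, hx⟩
  have hCC : C = C' := by
    ext x
    constructor
    · intro hx
      by_contra hx'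
      have := hfx x (hsub C hC hx)
      simp [hx, hx', hγ] at this
    · intro hx
      by_contra hx'
      have := hfx x (hsub C' hC' hx)
      simp [hx, hx', hγ'.symm] at this
  obtain ⟨x, hx⟩ := hne C hC
  have := hfx x (hsub C hC hx)
  rw [← hCC] at this ⊢
  simpa [hx] using this

/-! ### Counting the linear images and their cosets -/

theorem linImages_zeroSet_eq {k : S.Idx} {n : ℕ} (hn : S.s (S.block k) ≤ n) :
    S.linImages (S.zeroSet n k) =
      {H | ∃ v ∈ S.tail (S.s (S.block k - 1)), v ∉ S.tail (S.s (S.block k)) ∧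
        ∃ W ∈ S.tailOrbit n, H = AddSubgroup.adjoinLine (S.A k) v W} := by
  have hk : (k : ℕ) ≤ S.s (S.block k) := (S.block_le_iff k.le_m).1 le_rfl
  have hk' : S.s (S.block k - 1) < k := (S.block_spec k.one_le k.le_m).2.2.1
  ext H
  rw [linImages, zeroSet, ← adjoinLine_single_tail S (hk.trans hn)]
  constructor
  · rintro ⟨g, hg, rfl⟩
    refine ⟨g (Pi.single k 1), map_mem_tail hg ?_, ?_, _, ⟨g, hg, rfl⟩,
      AddSubgroup.map_adjoinLine g _ _⟩
    · rw [mem_tail]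
      refine ⟨single_mem_points (S.A k).one_mem, fun p hp => ?_⟩
      have : p ≠ k := by rintro rfl; omega
      simp [this]
    · rw [map_mem_tail_iff hg]
      intro h
      simpa using (mem_tail.1 h).2 k hk
  · rintro ⟨v, hv, hv', _, ⟨g, hg, rfl⟩, rfl⟩
    -- The vector and `W` can be prescribed independently: `g'` sends `e_k` to `g⁻¹ v` and fixes
    -- `tail n` pointwise, so `g * g'` sends `e_k` to `v` and still sends `tail n` to `W`.
    obtain ⟨g', hg', h1, h2⟩ := exists_apply_single_eq (k := k) (v := g.symm v)
      ((map_mem_tail_iff hg).1 (by rwa [LinearEquiv.apply_symm_apply]))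
      (fun h => hv' (by
        have := map_mem_tail hg h
        rwa [LinearEquiv.apply_symm_apply] at this))
    refine ⟨g * g', S.linGroup.mul_mem hg hg', ?_⟩
    rw [AddSubgroup.map_adjoinLine]
    have h3 : (g * g') (Pi.single k 1) = v := by
      change g (g' _) = v
      rw [h1, LinearEquiv.apply_symm_apply]
    rw [h3]
    congr 1
    ext x
    simp only [AddSubgroup.mem_map]
    refine exists_congr fun y => and_congr_right fun hy => ?_
    change g y = x ↔ g (g' y) = x
    rw [h2 y (S.tail_anti hn hy)]

theorem ncard_linImages_zeroSet {k q : S.Idx} (hkq : S.block k < S.block q) :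
    (S.linImages (S.zeroSet q k)).ncard =
      (∏ i ∈ Finset.Icc (S.s (S.block k) + 1) q, S.d i) *
        qBinom (S.A q) (S.μ (S.block q)) (q - S.s (S.block q - 1)) *
        qBinom (S.A k) (S.μ (S.block k)) 1 := by
  have hk := S.block_spec k.one_le k.le_m
  have hq := S.block_spec q.one_le q.le_m
  have hkq' : S.s (S.block k) ≤ S.s (S.block q - 1) := S.s_mono (by omega)
  have hn : S.s (S.block k) ≤ q := by omega
  have hs := S.s_succ (S.block k - 1)
  rw [Nat.sub_add_cancel hk.1] at hs
  have key := ncard_adjoinLine_mul (F := S.A k) (S.tail (S.s (S.block k)))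
    (S.tail (S.s (S.block k - 1))) (tail_le_tail_pred k)
    (fun c hc x hx => smul_mem_tail (S.s_mono (Nat.sub_le _ _)) hc hx)
    (fun c hc x hx => smul_mem_tail le_rfl hc hx)
    (S.tailOrbit q) (S.tail q : Set (S.Idx → K)).ncard
    (fun W hW => le_tail_of_mem_tailOrbit hn hW)
    (fun W hW => smul_mem_of_mem_tailOrbit (by omega) hW)
    (by rintro _ ⟨g, -, rfl⟩; exact ncard_map g _)
  rw [← linImages_zeroSet_eq hn, ncard_tailOrbit hq.2.2.1.le hq.2.2.2,
    ncard_tail_eq_mul (S.s_mono (Nat.sub_le (S.block k) 1)) (s_block_le_m k), prod_d_block le_rfl,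
    ← Nat.sub_one_mul, ncard_tail_eq_mul hn q.le_m,
    show S.s (S.block k) - S.s (S.block k - 1) = S.μ (S.block k) by omega] at key
  have h1 := qBinom_one_mul (S.A k) (S.μ (S.block k))
  have hd : S.d k = Nat.card (S.A k) := rfl
  -- Writing `d_k ^ μ - 1` as the number of lines times `d_k - 1` makes the fibre size a common
  -- factor to cancel.
  rw [hd, ← h1] at key
  have hpos : 0 < (Nat.card (S.A k) - 1) * (S.tail q : Set (S.Idx → K)).ncard :=
    Nat.mul_pos (by have := one_lt_d (S := S) k; omega) (ncard_tail_pos _)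
  refine Nat.eq_of_mul_eq_mul_right hpos (key.trans ?_)
  ring

theorem ncard_affPreimages_zeroSet {k q : S.Idx} (hkq : (k : ℕ) ≤ q) :
    (S.affPreimages (S.zeroSet q k)).ncard =
      (∏ i ∈ (Finset.Icc 1 (q : ℕ)).erase (k : ℕ), S.d i) *
        (S.linImages (S.zeroSet q k)).ncard := by
  have hH : S.zeroSet q k ≤ S.tail 0 := fun x hx => mem_tail_zero.2 hx.1
  have key := ncard_cosets_mul (S.tail 0) (S.linImages (S.zeroSet q k))
    (S.zeroSet q k : Set (S.Idx → K)).ncard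
    (by
      rintro _ ⟨g, hg, rfl⟩ _ ⟨x, hx, rfl⟩
      exact mem_tail_zero.2 (hg x hx.1))
    (by rintro _ ⟨g, -, rfl⟩; exact ncard_map g _)
  rw [← affPreimages_eq hH, ← ncard_zeroSet hkq q.le_m] at key
  have hpos : 0 < (S.zeroSet q k : Set (S.Idx → K)).ncard :=
    (Set.ncard_pos (Set.toFinite _)).2 ⟨0, (S.zeroSet q k).zero_mem⟩
  refine Nat.eq_of_mul_eq_mul_right hpos (key.trans ?_)
  ring

end NestedSubfields

theorem mainTheorem5 {K : Type*} [Field K] [Finite K] (S : NestedSubfields K)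
    (u j l : ℕ) (hj : j < S.m) (hl : 0 < l) (hl' : l < S.d (j + 1) - 1)
    (hu : u = (∑ i ∈ Finset.Icc 1 j, (S.d i - 1)) + l)
    (k : S.Idx) (hk : (k : ℕ) ≤ j + 1)
    (r : ℕ) (hr : r = S.block (j + 1)) (hkr : S.block k < r)
    (hdk : S.d k = S.d (j + 1) - l) :
    (S.words u k).ncard =
      (Nat.card K - 1) * (∏ i ∈ (Finset.Icc 1 (j + 1)).erase (k : ℕ), S.d i) *
        (∏ i ∈ Finset.Icc (S.s (S.block k) + 1) (j + 1), S.d i) *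
        qBinom (S.A (j + 1)) (S.μ r) (j + 1 - S.s (r - 1)) *
        qBinom (S.A k) (S.μ (S.block k)) 1 := by
  subst hr
  rw [NestedSubfields.words_eq_wordsOmega_empty ⟨hj, hl, hl'.le, hu⟩ hk hdk,
    NestedSubfields.ncard_wordsOmega_empty]
  let q : S.Idx := ⟨j + 1, Finset.mem_Icc.2 ⟨by omega, hj⟩⟩
  have h1 := NestedSubfields.ncard_affPreimages_zeroSet (k := k) (q := q) hk
  have h2 := NestedSubfields.ncard_linImages_zeroSet (k := k) (q := q) hkr
  rw [h2] at h1
  rw [h1]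
  ring
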